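/- Let $\mathcal H$ be a real or complex Hilbert space with norm $\|\cdot\|$, and let $\{\psi_j\}_{j=1}^\infty$ be a frame for $\mathcal H$ with bounds $A,B>0$, that is, $A\|g\|^2\le\sum_{j=1}^\infty|\langle g,\psi_j\rangle|^2\le B\|g\|^2$ for all $g\in\mathcal H$. Let $S g=\sum_{j=1}^\infty\langle g,\psi_j\rangle\psi_j$ be its frame operator, a bounded invertible operator on $\mathcal H$. For $n,m\in\mathbb N=\{1,2,\dots\}$ put $S_m g=\sum_{j=1}^m\langle g,\psi_j\rangle\psi_j$ and $\mathcal H_n=\operatorname{span}\{\psi_1,\dots,\psi_n\}$, let $P_n$ be the orthogonal projection of $\mathcal H$ onto $\mathcal H_n$, and let $V_n=P_nS_m|_{\mathcal H_n}:\mathcal H_n\to\mathcal H_n$. Let $\lambda_n$ be the smallest eigenvalue of the Gram matrix $\Psi_n=[\langle\psi_j,\psi_l\rangle]_{j,l=1}^n$ if $\Psi_n$ is invertible; if $\Psi_n$ is singular, let $\lambda_n$ be the smallest eigenvalue of any invertible principal submatrix of $\Psi_n$ whose indices $j$ are such that the corresponding $\psi_j$ still span $\mathcal H_n$. Suppose that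 for some $s>1$ and $c_0,c_1>0$ $$|\langle\psi_j,\psi_l\rangle|\le c_0(1+|j-l|)^{-s}\qquad(j,l\in\mathbb N),$$ and that $f\in\mathcal H$ satisfies $|\langle f,\psi_j\rangle|\le c_1\,j^{-s}$ for all $j\in\mathbb N$. Then there is a constant $c>0$, independent of $n$ and $m$ (and of the choice of submatrix), such that for every $n\in\mathbb N$ and every integer $$m\ \ge\ n+\left[\frac{2\,c_0^2\,n}{A(2s-1)\lambda_n}\right]^{\frac1{2s-1}}$$ the operator $V_n$ is invertible on $\mathcal H_n$ and $$\|S^{-1}f-V_n^{-1}P_nf\|\le c\,n^{-(s-1/2)}.$$ (If $\mathcal H_n=\{0\}$, the bracket is read as $0$ and $V_n^{-1}P_nf=0$.) -/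

import Mathlib

/-!
Sequences `ψ_1, ψ_2, …` are indexed from `0` here: the vector `ψ j` (`j : ℕ`) stands for
`ψ_{j+1}`, so that `ψ_1, …, ψ_n` are the `ψ j` with `j < n`. Differences of indices do not change.
Mathlib's `inner 𝕜 x y` is linear in `y`, so `⟨f, ψ_j⟩` is `inner 𝕜 (ψ j) f`.
-/

namespace CasazzaChristensen

variable (𝕜 : Type*) [RCLike 𝕜] {H : Type*} [NormedAddCommGroup H] [InnerProductSpace 𝕜 H]

/-- `ψ` is a frame for `H` with bounds `A` and `B`:
`A ‖f‖² ≤ ∑_j |⟨f, ψ_j⟩|² ≤ B ‖f‖²` for all `f`, the series being convergent. -/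
def IsFrame (ψ : ℕ → H) (A B : ℝ) : Prop :=
  0 < A ∧ 0 < B ∧ ∀ f : H,
    Summable (fun j => ‖inner 𝕜 (ψ j) f‖ ^ 2) ∧
    A * ‖f‖ ^ 2 ≤ ∑' j, ‖inner 𝕜 (ψ j) f‖ ^ 2 ∧
    ∑' j, ‖inner 𝕜 (ψ j) f‖ ^ 2 ≤ B * ‖f‖ ^ 2

/-- `S` is the frame operator of `ψ`: `S f = ∑_j ⟨f, ψ_j⟩ ψ_j` for every `f`, the series being
(unconditionally) convergent in `H`. This determines `S`. -/
def IsFrameOperator (ψ : ℕ → H) (S : H →L[𝕜] H) : Prop :=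
  ∀ f : H, HasSum (fun j => inner 𝕜 (ψ j) f • ψ j) (S f)

/-- Off-diagonal decay of the Gram matrix with rate `s`:
`|⟨ψ_j, ψ_l⟩| ≤ c₀ (1 + |j - l|)^{-s}` for all `j, l`. -/
def IsSelfLocalized (ψ : ℕ → H) (c₀ s : ℝ) : Prop :=
  0 < c₀ ∧ ∀ j l : ℕ, ‖inner 𝕜 (ψ l) (ψ j)‖ ≤ c₀ * (1 + |(j : ℝ) - (l : ℝ)|) ^ (-s)

/-- Decay of the frame coefficients: `|⟨f, ψ_j⟩| ≤ c j^{-s}` for `j = 1, 2, …`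
(one-based `j`, which is `j + 1` below). -/
def HasCoeffDecay (ψ : ℕ → H) (f : H) (c s : ℝ) : Prop :=
  0 < c ∧ ∀ j : ℕ, ‖inner 𝕜 (ψ j) f‖ ≤ c * ((j : ℝ) + 1) ^ (-s)

/-- `H_n`, the span of the first `n` frame elements. -/
def headSpan (ψ : ℕ → H) (n : ℕ) : Submodule 𝕜 H :=
  Submodule.span 𝕜 (Set.range fun i : Fin n => ψ i)

instance instFiniteDimensionalHeadSpan (ψ : ℕ → H) (n : ℕ) :
    FiniteDimensional 𝕜 (headSpan 𝕜 ψ n) :=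
  FiniteDimensional.span_of_finite 𝕜 (Set.finite_range _)

/-- `P_n`, the orthogonal projection from `H` onto `H_n`. -/
noncomputable def headProj (ψ : ℕ → H) (n : ℕ) : H →L[𝕜] headSpan 𝕜 ψ n :=
  (headSpan 𝕜 ψ n).orthogonalProjectionOnto

/-- `S_m f = ∑_{j=1}^m ⟨f, ψ_j⟩ ψ_j`. -/
noncomputable def partialFrameOp (ψ : ℕ → H) (m : ℕ) : H →L[𝕜] H :=
  ∑ j ∈ Finset.range m, (innerSL 𝕜 (ψ j)).smulRight (ψ j)

/-- `V_n`, the restriction of `P_n S_m` to `H_n`, as an operator on `H_n`. -/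
noncomputable def compressedOp (ψ : ℕ → H) (n m : ℕ) :
    headSpan 𝕜 ψ n →L[𝕜] headSpan 𝕜 ψ n :=
  (headProj 𝕜 ψ n ∘L partialFrameOp 𝕜 ψ m) ∘L (headSpan 𝕜 ψ n).subtypeL

/-- `Ψ_n`, the Gram matrix of `ψ_1, …, ψ_n`. -/
def gramMatrix (ψ : ℕ → H) (n : ℕ) : Matrix (Fin n) (Fin n) 𝕜 :=
  Matrix.gram 𝕜 fun i : Fin n => ψ i

/-- The principal submatrix of `Ψ_n` with rows and columns in `J`;
for `J = Finset.univ` this is `Ψ_n` up to renaming the indices. -/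
def gramSubmatrix (ψ : ℕ → H) (n : ℕ) (J : Finset (Fin n)) : Matrix J J 𝕜 :=
  (gramMatrix 𝕜 ψ n).submatrix (fun i : J => (i : Fin n)) (fun i : J => (i : Fin n))

theorem gramSubmatrix_isHermitian (ψ : ℕ → H) (n : ℕ) (J : Finset (Fin n)) :
    (gramSubmatrix 𝕜 ψ n J).IsHermitian :=
  (Matrix.isHermitian_gram 𝕜 _).submatrix _

/-- The smallest eigenvalue of the principal submatrix of `Ψ_n` with index set `J`. -/
noncomputable def gramMinEigenvalue (ψ : ℕ → H) (n : ℕ) (J : Finset (Fin n)) : ℝ :=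
  ⨅ i : J, (gramSubmatrix_isHermitian 𝕜 ψ n J).eigenvalues i

/-- The principal submatrix of `Ψ_n` with index set `J` is invertible, and the `ψ_j` with `j ∈ J`
still span `H_n`; so it is an invertible principal submatrix of the largest order. If `Ψ_n` itself
is invertible, the only such `J` is the whole index set, and if `Ψ_n` is singular, the submatrix
takes its place. -/
def IsGramCore (ψ : ℕ → H) (n : ℕ) (J : Finset (Fin n)) : Prop :=
  IsUnit (gramSubmatrix 𝕜 ψ n J).det ∧
  Submodule.span 𝕜 (Set.range fun i : J => ψ (i : Fin n)) = headSpan 𝕜 ψ n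

/-- The number of samples
`n + [2 c₀² n / (A (2s-1) lam)]^{1/(2s-1)}`, a real number that is to be rounded up;
`lam` is the smallest eigenvalue of the Gram matrix. -/
noncomputable def sampleSize (A c₀ s lam : ℝ) (n : ℕ) : ℝ :=
  (n : ℝ) + (2 * c₀ ^ 2 * (n : ℝ) / (A * (2 * s - 1) * lam)) ^ (1 / (2 * s - 1))

end CasazzaChristensen

open Filter Topology


namespace CasazzaChristensen

/-! Put g = S⁻¹f and k = S⁻¹g. The form ⟨V_n v, v⟩ is the frame sum of v cut off at m, and the
sample size keeps the missing tail below (A/2)‖v‖² on H_n (`IsFrame.half_lower_bound_on_headSpan`).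
Hence V_n is invertible with ‖V_n⁻¹‖ ≤ 2/A uniformly, and only truncation errors remain: S_m g
approximates f = Sg, and S_n k, which lies in H_n, approximates g = Sk. Both are O(n^{-(s-1/2)})
once the frame coefficients of g and k decay like j^{-s}.

The deep point is that S⁻¹ preserves this decay with the same exponent
(`DecaysAt.inverse_frameOperator`), a theorem of Jaffard type. Newton iteration for S⁻¹ starts from
a multiple of the identity and has residuals R^(2^i) with ‖R‖ < 1. Interpolating the decay bound
with a uniform bound on matrix entries (`exists_convolution_bound`), a Newton step turns a decay
constant a into at most C a^(2-t), so log a grows more slowly than 2^i (`exists_subexponential`). At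
a late stage the residual X therefore shrinks norms much faster than it enlarges decay constants,
and a second interpolation makes a Neumann series in X² converge with decay. -/

/-! ### Polynomial weights on `ℕ × ℕ` -/

/-- The polynomially decaying weight `(1 + |j - l|)^{-s}`. -/
noncomputable def decayWeight (s : ℝ) (j l : ℕ) : ℝ := (1 + |(j : ℝ) - (l : ℝ)|) ^ (-s)

/-- The two-sided sum `∑_z (1 + |z|)^{-p}`, which dominates all row sums of `decayWeight p`. -/
noncomputable def decaySum (p : ℝ) : ℝ := ∑' z : ℤ, (1 + |(z : ℝ)|) ^ (-p)

theorem decayWeight_pos (s : ℝ) (j l : ℕ) : 0 < decayWeight s j l := by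
  unfold decayWeight; positivity

theorem decayWeight_comm (s : ℝ) (j l : ℕ) : decayWeight s j l = decayWeight s l j := by
  unfold decayWeight; rw [abs_sub_comm]

theorem decayWeight_le_one {s : ℝ} (hs : 0 ≤ s) (j l : ℕ) : decayWeight s j l ≤ 1 := by
  unfold decayWeight
  apply Real.rpow_le_one_of_one_le_of_nonpos
  · linarith [abs_nonneg ((j : ℝ) - l)]
  · linarith

theorem decayWeight_rpow (s t : ℝ) (j l : ℕ) :
    decayWeight s j l ^ t = decayWeight (s * t) j l := by
  unfold decayWeight
  rw [← Real.rpow_mul (by positivity)]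
  ring_nf

theorem summable_int_decay {p : ℝ} (hp : 1 < p) :
    Summable fun z : ℤ => (1 + |(z : ℝ)|) ^ (-p) := by
  have h : Summable fun n : ℕ => (1 + |(n : ℝ)|) ^ (-p) := by
    refine ((Real.summable_one_div_nat_add_rpow 1 p).2 hp).congr fun n => ?_
    have h0 : (0 : ℝ) ≤ n := n.cast_nonneg
    rw [abs_of_nonneg h0, abs_of_nonneg (by linarith), Real.rpow_neg (by linarith), one_div,
      add_comm]
  refine Summable.of_nat_of_neg ?_ ?_
  · simpa using h
  · simpa using h

theorem decaySum_nonneg (p : ℝ) : 0 ≤ decaySum p :=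
  tsum_nonneg fun _ => by positivity

theorem summable_decayWeight {p : ℝ} (hp : 1 < p) (l : ℕ) :
    Summable fun i => decayWeight p i l := by
  have hinj : Function.Injective fun i : ℕ => (i : ℤ) - l := fun a b h => by
    simpa using h
  have := (summable_int_decay hp).comp_injective hinj
  refine this.congr fun i => ?_
  simp [decayWeight]

theorem tsum_decayWeight_le {p : ℝ} (hp : 1 < p) (l : ℕ) :
    ∑' i, decayWeight p i l ≤ decaySum p := by
  have hinj : Function.Injective fun i : ℕ => (i : ℤ) - l := fun a b h => by
    simpa using h
  have := tsum_comp_le_tsum_of_inj (summable_int_decay hp) (fun _ => by positivity) hinj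
  refine le_trans (le_of_eq (tsum_congr fun i => ?_)) this
  simp [decayWeight]

theorem decayWeight_le_of_half_le {s : ℝ} (hs : 0 ≤ s) {i j k l : ℕ}
    (h : 1 + |(k : ℝ) - l| ≤ 2 * (1 + |(i : ℝ) - j|)) :
    decayWeight s i j ≤ 2 ^ s * decayWeight s k l := by
  unfold decayWeight
  have h1 : (2 : ℝ) ^ s * (1 + |(k : ℝ) - l|) ^ (-s) = ((1 + |(k : ℝ) - l|) / 2) ^ (-s) := by
    rw [Real.div_rpow (by positivity) (by positivity), Real.rpow_neg (x := 2) (by positivity)]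
    field_simp
  rw [h1]
  exact Real.rpow_le_rpow_of_nonpos (by positivity) (by linarith) (by linarith)

/-- Split x = x^t x^(1-t) and use one bound on each factor. Part of the decay exponent is traded for
a power of the sup bound ε; this is the source of the exponent 2 - t in the Newton step. -/
theorem le_interpolate {x b ε w t : ℝ} (hx : 0 ≤ x) (hb : 0 ≤ b) (hw : 0 ≤ w)
    (ht0 : 0 ≤ t) (ht1 : t ≤ 1) (h1 : x ≤ ε) (h2 : x ≤ b * w) :
    x ≤ ε ^ t * b ^ (1 - t) * w ^ (1 - t) := by
  calc x = x ^ t * x ^ (1 - t) := by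
        rw [← Real.rpow_add_of_nonneg hx ht0 (by linarith)]; simp
    _ ≤ ε ^ t * (b * w) ^ (1 - t) := by
        have := Real.rpow_le_rpow hx h1 ht0
        have := Real.rpow_le_rpow hx h2 (sub_nonneg.2 ht1)
        gcongr
        exact Real.rpow_nonneg (hx.trans h1) _
    _ = _ := by rw [Real.mul_rpow hb hw]; ring

/-- Interpolation of the sup norm with the weighted sup norm controls products of
off-diagonally decaying matrices. -/
theorem exists_convolution_bound {s t : ℝ} (hs : 0 ≤ s) (ht0 : 0 ≤ t) (ht1 : t ≤ 1)
    (hst : 1 < s * (1 - t)) {j l : ℕ} {a b ε δ : ℝ} {x y : ℕ → ℝ}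
    (ha : 0 ≤ a) (hb : 0 ≤ b)
    (hx0 : ∀ i, 0 ≤ x i) (hy0 : ∀ i, 0 ≤ y i)
    (hx : ∀ i, x i ≤ a * decayWeight s j i) (hxε : ∀ i, x i ≤ ε)
    (hy : ∀ i, y i ≤ b * decayWeight s i l) (hyδ : ∀ i, y i ≤ δ) :
    ∃ g : ℕ → ℝ, Summable g ∧ (∀ i, x i * y i ≤ g i) ∧
      ∑' i, g i ≤ 2 ^ s * decaySum (s * (1 - t)) *
        (a * (δ ^ t * b ^ (1 - t)) + b * (ε ^ t * a ^ (1 - t))) * decayWeight s j l := by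
  have hε : 0 ≤ ε := (hx0 0).trans (hxε 0)
  have hδ : 0 ≤ δ := (hy0 0).trans (hyδ 0)
  set p := s * (1 - t) with hp
  set W := 2 ^ s * decayWeight s j l with hW
  have hW0 : 0 ≤ W := by have := decayWeight_pos s j l; positivity
  set P := a * (δ ^ t * b ^ (1 - t)) with hP
  set Q := b * (ε ^ t * a ^ (1 - t)) with hQ
  have hP0 : 0 ≤ P := by positivity
  have hQ0 : 0 ≤ Q := by positivity
  have hyi : ∀ i, y i ≤ δ ^ t * b ^ (1 - t) * decayWeight p i l := fun i => by
    have := le_interpolate (hy0 i) hb (decayWeight_pos s i l).le ht0 ht1 (hyδ i) (hy i)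
    rwa [decayWeight_rpow] at this
  have hxi : ∀ i, x i ≤ ε ^ t * a ^ (1 - t) * decayWeight p i j := fun i => by
    have := le_interpolate (hx0 i) ha (decayWeight_pos s j i).le ht0 ht1 (hxε i) (hx i)
    rwa [decayWeight_rpow, decayWeight_comm] at this
  have S1 := (summable_decayWeight hst l).mul_left (W * P)
  have S2 := (summable_decayWeight hst j).mul_left (W * Q)
  refine ⟨fun i => W * P * decayWeight p i l + W * Q * decayWeight p i j, S1.add S2,
    fun i => ?_, ?_⟩
  · have h1 : 0 ≤ W * P * decayWeight p i l := by have := decayWeight_pos p i l; positivity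
    have h2 : 0 ≤ W * Q * decayWeight p i j := by have := decayWeight_pos p i j; positivity
    have htri : |(j : ℝ) - l| ≤ |(j : ℝ) - i| + |(i : ℝ) - l| := abs_sub_le _ _ _
    -- One of the two distances is at least half of |j - l|. That factor supplies the full weight W;
    -- the other is interpolated and is summable in i, since its exponent s(1-t) exceeds 1.
    rcases le_total |(i : ℝ) - l| |(j : ℝ) - i| with h | h
    · have hd := decayWeight_le_of_half_le hs (i := j) (j := i) (k := j) (l := l) (by linarith)
      have : x i * y i ≤ (a * W) * (δ ^ t * b ^ (1 - t) * decayWeight p i l) :=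
        mul_le_mul ((hx i).trans (mul_le_mul_of_nonneg_left hd ha)) (hyi i) (hy0 i)
          (by positivity)
      calc x i * y i ≤ _ := this
        _ = W * P * decayWeight p i l := by rw [hP]; ring
        _ ≤ _ := by linarith
    · have hd := decayWeight_le_of_half_le hs (i := i) (j := l) (k := j) (l := l) (by linarith)
      have : x i * y i ≤ (ε ^ t * a ^ (1 - t) * decayWeight p i j) * (b * W) :=
        mul_le_mul (hxi i) ((hy i).trans (mul_le_mul_of_nonneg_left hd hb)) (hy0 i)
          (by have := decayWeight_pos p i j; positivity)
      calc x i * y i ≤ _ := this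
        _ = W * Q * decayWeight p i j := by rw [hQ]; ring
        _ ≤ _ := by linarith
  · rw [S1.tsum_add S2, tsum_mul_left, tsum_mul_left]
    have h1 := mul_le_mul_of_nonneg_left (tsum_decayWeight_le hst l) (mul_nonneg hW0 hP0)
    have h2 := mul_le_mul_of_nonneg_left (tsum_decayWeight_le hst j) (mul_nonneg hW0 hQ0)
    calc _ ≤ W * P * decaySum p + W * Q * decaySum p := add_le_add h1 h2
      _ = _ := by rw [hW]; ring

/-! ### Tails of the zeta series -/

/-- The right side is the integral of z^(-r) over [y-1, y]. The proof avoids integrals: after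
dividing by y^(-(r-1)) it is the Bernoulli inequality `h2`, from log z ≤ z - 1 and 1 + z ≤ exp z. -/
theorem rpow_neg_le_telescope {r y : ℝ} (hr : 1 < r) (hy : 1 < y) :
    y ^ (-r) ≤ ((y - 1) ^ (-(r - 1)) - y ^ (-(r - 1))) / (r - 1) := by
  have hy0 : 0 < y := by linarith
  have h1 : 0 < 1 - 1 / y := by
    have : 1 / y < 1 := by rw [div_lt_one hy0]; exact hy
    linarith
  have h2 : 1 + (r - 1) / y ≤ (1 - 1 / y) ^ (-(r - 1)) := by
    have h3 : Real.log (1 - 1 / y) ≤ -(1 / y) := by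
      have := Real.log_le_sub_one_of_pos h1; linarith
    rw [Real.rpow_def_of_pos h1]
    have h4 : (r - 1) / y ≤ Real.log (1 - 1 / y) * (-(r - 1)) := by
      have := mul_le_mul_of_nonneg_right h3 (by linarith : (0 : ℝ) ≤ r - 1)
      have e : (r - 1) / y = 1 / y * (r - 1) := by ring
      rw [e]; linarith
    linarith [Real.add_one_le_exp ((r - 1) / y), Real.exp_le_exp.2 h4]
  rw [le_div_iff₀ (by linarith)]
  have e1 : (y - 1) ^ (-(r - 1)) = y ^ (-(r - 1)) * (1 - 1 / y) ^ (-(r - 1)) := by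
    rw [← Real.mul_rpow hy0.le h1.le]
    congr 1
    field_simp
  have e2 : y ^ (-r) = y ^ (-(r - 1)) / y := by
    rw [← Real.rpow_sub_one hy0.ne']
    congr 1
    ring
  have hpos : 0 < y ^ (-(r - 1)) := by positivity
  have h5 := mul_le_mul_of_nonneg_left h2 hpos.le
  rw [e1, e2]
  have e3 : y ^ (-(r - 1)) / y * (r - 1) = y ^ (-(r - 1)) * ((r - 1) / y) := by ring
  rw [e3]
  linarith

theorem sum_rpow_neg_shift_le {r x : ℝ} (hr : 1 < r) (hx : 0 < x) (N : ℕ) :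
    ∑ i ∈ Finset.range N, (x + 1 + i) ^ (-r) ≤ x ^ (-(r - 1)) / (r - 1) := by
  have key : ∑ i ∈ Finset.range N, (x + 1 + i) ^ (-r) ≤
      (x ^ (-(r - 1)) - (x + N) ^ (-(r - 1))) / (r - 1) := by
    induction N with
    | zero => simp
    | succ N ih =>
      have hN : (0 : ℝ) ≤ N := N.cast_nonneg
      rw [Finset.sum_range_succ]
      have h := rpow_neg_le_telescope hr (y := x + 1 + N) (by linarith)
      have e : x + 1 + N - 1 = x + N := by ring
      rw [e] at h
      push_cast
      have e' : x + (N + 1) = x + 1 + (N : ℝ) := by ring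
      rw [e']
      calc _ ≤ _ := add_le_add ih h
        _ = _ := by ring
  refine key.trans ?_
  have : 0 ≤ (x + N) ^ (-(r - 1)) := by positivity
  gcongr
  · linarith

/-- A sequence with `y i ≤ D (x + 1 + i)^{-r}` sums to at most `D x^{-(r-1)} / (r-1)`. -/
theorem tsum_le_of_le_rpow_neg_shift {r x D : ℝ} (hr : 1 < r) (hx : 0 < x) (hD : 0 ≤ D)
    {y : ℕ → ℝ} (hy0 : ∀ i, 0 ≤ y i) (hy : ∀ i, y i ≤ D * (x + 1 + i) ^ (-r)) :
    ∑' i, y i ≤ D * (x ^ (-(r - 1)) / (r - 1)) := by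
  refine Real.tsum_le_of_sum_range_le hy0 fun N => ?_
  calc _ ≤ ∑ i ∈ Finset.range N, D * (x + 1 + i) ^ (-r) := Finset.sum_le_sum fun i _ => hy i
    _ = D * ∑ i ∈ Finset.range N, (x + 1 + i) ^ (-r) := by rw [Finset.mul_sum]
    _ ≤ _ := mul_le_mul_of_nonneg_left (sum_rpow_neg_shift_le hr hx N) hD

/-! ### Sequences growing subexponentially along powers of two -/

/-- If a property of constants is inherited from `a` by `C a^θ` with `θ < 2`, then along the
doubling scale the constants grow more slowly than any `β ^ (2 ^ i)`. -/
theorem exists_subexponential {C θ a₀ D β : ℝ} (hC : 1 ≤ C) (hθ1 : 1 < θ) (hθ2 : θ < 2)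
    (hD : 0 ≤ D) (hβ : 1 < β) {p : ℕ → ℝ → Prop}
    (h0 : ∀ a, a₀ ≤ a → p 0 a)
    (hstep : ∀ i a, 1 ≤ a → p i a → p (i + 1) (C * a ^ θ)) :
    ∃ i a, 1 ≤ a ∧ p i a ∧ 1 + D * a ≤ β ^ (2 ^ i) := by
  -- The shift c is chosen so that log a + c is multiplied by exactly θ under a ↦ C a^θ; hence the
  -- explicit orbit exp(Λ θ^i - c).
  set c := Real.log C / (θ - 1) with hc
  have hθ : 0 < θ - 1 := by linarith
  have hc0 : 0 ≤ c := div_nonneg (Real.log_nonneg hC) hθ.le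
  set Λ := c + Real.log (max 1 a₀) with hΛ
  have hl0 : 0 ≤ Real.log (max 1 a₀) := Real.log_nonneg (le_max_left _ _)
  have hΛ0 : 0 ≤ Λ := by linarith
  have hge : ∀ i : ℕ, Λ ≤ Λ * θ ^ i := fun i =>
    le_mul_of_one_le_right hΛ0 (one_le_pow₀ hθ1.le)
  have hone : ∀ i : ℕ, 1 ≤ Real.exp (Λ * θ ^ i - c) := fun i =>
    Real.one_le_exp (by linarith [hge i])
  have hp : ∀ i : ℕ, p i (Real.exp (Λ * θ ^ i - c)) := by
    intro i
    induction i with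
    | zero =>
      apply h0
      have : Λ * θ ^ 0 - c = Real.log (max 1 a₀) := by rw [hΛ]; ring
      rw [this, Real.exp_log (lt_of_lt_of_le one_pos (le_max_left _ _))]
      exact le_max_right _ _
    | succ i ih =>
      have := hstep i _ (hone i) ih
      convert this using 1
      rw [← Real.exp_mul]
      nth_rewrite 1 [← Real.exp_log (show 0 < C by linarith)]
      rw [← Real.exp_add]
      congr 1
      have : Real.log C = c * (θ - 1) := by rw [hc]; field_simp
      rw [this]; ring
  -- This is an upper bound for log(1 + D a_i) divided by 2^i; it tends to 0 because θ < 2.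
  have hlim : Tendsto (fun i : ℕ => Real.log (1 + D) * (1 / 2) ^ i + Λ * (θ / 2) ^ i) atTop
      (𝓝 (Real.log (1 + D) * 0 + Λ * 0)) :=
    ((tendsto_pow_atTop_nhds_zero_of_lt_one (by norm_num) (by norm_num)).const_mul _).add
      ((tendsto_pow_atTop_nhds_zero_of_lt_one (by linarith) (by linarith)).const_mul _)
  have hlogβ : 0 < Real.log β := Real.log_pos hβ
  obtain ⟨i, hi⟩ := (hlim.eventually_lt_const (show _ < Real.log β by simpa using hlogβ)).exists
  refine ⟨i, _, hone i, hp i, ?_⟩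
  have h2 : (0 : ℝ) < 2 ^ i := by positivity
  have hi' : Real.log (1 + D) + Λ * θ ^ i ≤ Real.log β * 2 ^ i := by
    have := mul_le_mul_of_nonneg_right hi.le h2.le
    rw [add_mul, mul_assoc, mul_assoc, ← mul_pow, ← mul_pow] at this
    simpa using this
  have hexp1 : 1 ≤ Real.exp (Λ * θ ^ i) := Real.one_le_exp (by linarith [hge i])
  have hexp2 : Real.exp (Λ * θ ^ i - c) ≤ Real.exp (Λ * θ ^ i) := Real.exp_le_exp.2 (by linarith)
  calc 1 + D * Real.exp (Λ * θ ^ i - c) ≤ (1 + D) * Real.exp (Λ * θ ^ i) := by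
        nlinarith [mul_le_mul_of_nonneg_left hexp2 hD]
    _ = Real.exp (Real.log (1 + D) + Λ * θ ^ i) := by
        rw [Real.exp_add, Real.exp_log (by linarith)]
    _ ≤ Real.exp (Real.log β * 2 ^ i) := Real.exp_le_exp.2 hi'
    _ = β ^ (2 ^ i) := by
        rw [Real.exp_mul, Real.exp_log (by linarith)]
        exact_mod_cast Real.rpow_natCast β (2 ^ i)

end CasazzaChristensen


namespace CasazzaChristensen

/-! ### Bessel bounds, truncation, and existence and invertibility of the frame operator -/

section FrameOperator

variable {𝕜 : Type*} [RCLike 𝕜] {H : Type*} [NormedAddCommGroup H] [InnerProductSpace 𝕜 H]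
variable {ψ : ℕ → H} {A B : ℝ}

theorem IsFrame.sum_sq_le (h : IsFrame 𝕜 ψ A B) (F : Finset ℕ) (u : H) :
    ∑ j ∈ F, ‖inner 𝕜 (ψ j) u‖ ^ 2 ≤ B * ‖u‖ ^ 2 :=
  ((h.2.2 u).1.sum_le_tsum F fun _ _ => by positivity).trans (h.2.2 u).2.2

/-- The dual form of the Bessel inequality. -/
theorem IsFrame.norm_sum_smul_sq_le (h : IsFrame 𝕜 ψ A B) (F : Finset ℕ) (c : ℕ → 𝕜) :
    ‖∑ j ∈ F, c j • ψ j‖ ^ 2 ≤ B * ∑ j ∈ F, ‖c j‖ ^ 2 := by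
  set v := ∑ j ∈ F, c j • ψ j with hv
  have h1 : ‖v‖ ^ 2 ≤ ∑ j ∈ F, ‖c j‖ * ‖inner 𝕜 (ψ j) v‖ := by
    have : (inner 𝕜 v v : 𝕜) = ∑ j ∈ F, c j * inner 𝕜 v (ψ j) := by
      conv_lhs => rw [hv, ← hv]
      nth_rewrite 2 [hv]
      rw [inner_sum]
      simp [inner_smul_right]
    calc ‖v‖ ^ 2 = ‖(inner 𝕜 v v : 𝕜)‖ := by
          rw [inner_self_eq_norm_sq_to_K]; simp
      _ ≤ ∑ j ∈ F, ‖c j * inner 𝕜 v (ψ j)‖ := by rw [this]; exact norm_sum_le _ _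
      _ = _ := Finset.sum_congr rfl fun j _ => by rw [norm_mul, norm_inner_symm]
  have h2 := Finset.sum_mul_sq_le_sq_mul_sq F (fun j => ‖c j‖) (fun j => ‖inner 𝕜 (ψ j) v‖)
  have h3 := h.sum_sq_le F v
  have h4 : 0 ≤ ∑ j ∈ F, ‖c j‖ ^ 2 := Finset.sum_nonneg fun _ _ => by positivity
  have hB := h.2.1
  -- If the bound fails, then ‖v‖² > 0, so it can be cancelled from ‖v‖⁴ ≤ (∑ ‖c j‖²) B ‖v‖².
  by_contra hcon
  push Not at hcon
  have hpos : 0 < ‖v‖ ^ 2 := lt_of_le_of_lt (by positivity) hcon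
  have h5 : (‖v‖ ^ 2) ^ 2 ≤ (∑ j ∈ F, ‖c j‖ ^ 2) * (B * ‖v‖ ^ 2) :=
    (pow_le_pow_left₀ hpos.le h1 2).trans (h2.trans (mul_le_mul_of_nonneg_left h3 h4))
  nlinarith

theorem IsFrame.norm_sq_le_of_hasSum (h : IsFrame 𝕜 ψ A B) {c : ℕ → 𝕜} {v : H}
    (hv : HasSum (fun j => c j • ψ j) v) (hc : Summable fun j => ‖c j‖ ^ 2) :
    ‖v‖ ^ 2 ≤ B * ∑' j, ‖c j‖ ^ 2 := by
  have ht : Tendsto (fun F : Finset ℕ => ‖∑ j ∈ F, c j • ψ j‖ ^ 2) atTop (𝓝 (‖v‖ ^ 2)) :=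
    (Tendsto.norm hv).pow 2
  refine le_of_tendsto ht (Eventually.of_forall fun F => ?_)
  refine (h.norm_sum_smul_sq_le F c).trans (mul_le_mul_of_nonneg_left ?_ h.2.1.le)
  exact hc.sum_le_tsum F fun _ _ => by positivity

theorem partialFrameOp_apply (ψ : ℕ → H) (m : ℕ) (u : H) :
    partialFrameOp 𝕜 ψ m u = ∑ j ∈ Finset.range m, inner 𝕜 (ψ j) u • ψ j := by
  simp [partialFrameOp]

theorem IsFrame.norm_partialFrameOp_le (h : IsFrame 𝕜 ψ A B) (m : ℕ) (u : H) :
    ‖partialFrameOp 𝕜 ψ m u‖ ≤ B * ‖u‖ := by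
  have hB := h.2.1
  refine abs_le_of_sq_le_sq' ?_ (by positivity) |>.2
  rw [partialFrameOp_apply]
  have h1 := h.norm_sum_smul_sq_le (Finset.range m) (fun j => inner 𝕜 (ψ j) u)
  have h2 := mul_le_mul_of_nonneg_left (h.sum_sq_le (Finset.range m) u) hB.le
  nlinarith

/-- The difference is the frame expansion with the first m coefficients replaced by 0, so the dual
Bessel inequality applies. -/
theorem IsFrame.norm_sub_partialFrameOp_sq_le (h : IsFrame 𝕜 ψ A B) {S : H →L[𝕜] H}
    (hS : IsFrameOperator 𝕜 ψ S) (m : ℕ) (u : H) :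
    ‖S u - partialFrameOp 𝕜 ψ m u‖ ^ 2 ≤ B * ∑' i, ‖inner 𝕜 (ψ (i + m)) u‖ ^ 2 := by
  set c : ℕ → 𝕜 := fun j => if j < m then 0 else inner 𝕜 (ψ j) u with hc
  have hsum : HasSum (fun j => c j • ψ j) (S u - partialFrameOp 𝕜 ψ m u) := by
    have h1 := hasSum_sum_of_ne_finset_zero (L := SummationFilter.unconditional ℕ)
      (s := Finset.range m)
      (f := fun j => if j < m then (inner 𝕜 (ψ j) u : 𝕜) • ψ j else 0)
      (fun j hj => by simp only [Finset.mem_range] at hj; simp [hj])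
    have h2 : ∑ j ∈ Finset.range m, (if j < m then (inner 𝕜 (ψ j) u : 𝕜) • ψ j else 0) =
        partialFrameOp 𝕜 ψ m u := by
      rw [partialFrameOp_apply]
      exact Finset.sum_congr rfl fun j hj => by simp [Finset.mem_range.1 hj]
    rw [h2] at h1
    convert (hS u).sub h1 using 2 with j
    by_cases hj : j < m <;> simp [hc, hj]
  have hs : Summable fun j => ‖c j‖ ^ 2 := by
    refine Summable.of_nonneg_of_le (fun _ => by positivity) (fun j => ?_) (h.2.2 u).1
    by_cases hj : j < m <;> simp [hc, hj]
  refine (h.norm_sq_le_of_hasSum hsum hs).trans_eq ?_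
  congr 1
  rw [← hs.sum_add_tsum_nat_add m, Finset.sum_eq_zero, zero_add]
  · exact tsum_congr fun i => by simp [hc]
  · intro j hj
    simp [hc, Finset.mem_range.1 hj]

theorem hasSum_inner_frameOperator {S : H →L[𝕜] H} (hS : IsFrameOperator 𝕜 ψ S) (u : H) :
    HasSum (fun j => ‖inner 𝕜 (ψ j) u‖ ^ 2) (RCLike.re (inner 𝕜 u (S u) : 𝕜)) := by
  have h1 := (hS u).mapL (innerSL 𝕜 u)
  have h2 := h1.mapL (RCLike.reCLM (K := 𝕜))
  refine h2.congr_fun fun j => ?_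
  change _ = RCLike.re (inner 𝕜 u ((inner 𝕜 (ψ j) u : 𝕜) • ψ j) : 𝕜)
  rw [inner_smul_right]
  rw [← inner_conj_symm u, RCLike.mul_conj]
  norm_cast

/-- The residual of the frame algorithm with relaxation parameter `1 / B` is a contraction. -/
theorem IsFrame.norm_one_sub_frameOperator_lt_one (h : IsFrame 𝕜 ψ A B) {S : H →L[𝕜] H}
    (hS : IsFrameOperator 𝕜 ψ S) : ‖1 - ((B⁻¹ : ℝ) : 𝕜) • S‖ < 1 := by
  have hA := h.1
  have hB := h.2.1
  set q := Real.sqrt (1 - A / B) with hq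
  have hq1 : q < 1 := by
    rw [hq, Real.sqrt_lt' one_pos]
    have : 0 < A / B := by positivity
    linarith
  refine lt_of_le_of_lt (ContinuousLinearMap.opNorm_le_bound _ (Real.sqrt_nonneg _) fun u => ?_) hq1
  set ρ := RCLike.re (inner 𝕜 u (S u) : 𝕜) with hρ
  have hsum := hasSum_inner_frameOperator hS u
  have h1 : A * ‖u‖ ^ 2 ≤ ρ := by rw [hρ, ← hsum.tsum_eq]; exact (h.2.2 u).2.1
  have h2 : ‖S u‖ ^ 2 ≤ B * ρ := by
    rw [hρ, ← hsum.tsum_eq]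
    exact h.norm_sq_le_of_hasSum (hS u) (h.2.2 u).1
  have h3 : ‖u - ((B⁻¹ : ℝ) : 𝕜) • S u‖ ^ 2 =
      ‖u‖ ^ 2 - 2 * (B⁻¹ * ρ) + B⁻¹ ^ 2 * ‖S u‖ ^ 2 := by
    rw [@norm_sub_sq 𝕜, inner_smul_right, RCLike.re_ofReal_mul, norm_smul, RCLike.norm_ofReal,
      mul_pow, sq_abs]
  have h4 : ‖u - ((B⁻¹ : ℝ) : 𝕜) • S u‖ ^ 2 ≤ (1 - A / B) * ‖u‖ ^ 2 := by
    have h5 : B⁻¹ ^ 2 * ‖S u‖ ^ 2 ≤ B⁻¹ * ρ := by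
      calc _ ≤ B⁻¹ ^ 2 * (B * ρ) := by gcongr
        _ = _ := by field_simp
    have h6 : A / B * ‖u‖ ^ 2 ≤ B⁻¹ * ρ := by
      calc A / B * ‖u‖ ^ 2 = B⁻¹ * (A * ‖u‖ ^ 2) := by ring
        _ ≤ _ := by gcongr
    rw [h3]; linarith
  have h7 : ‖u - ((B⁻¹ : ℝ) : 𝕜) • S u‖ ≤ q * ‖u‖ := by
    refine abs_le_of_sq_le_sq' ?_ (by positivity) |>.2
    rw [mul_pow]
    refine h4.trans (mul_le_mul_of_nonneg_right ?_ (by positivity))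
    -- If H is trivial, nothing forces A ≤ B; then 1 - A/B may be negative and `Real.sqrt` returns
    -- 0.
    rcases le_total 0 (1 - A / B) with h0 | h0
    · rw [hq, Real.sq_sqrt h0]
    · exact h0.trans (sq_nonneg _)
  simpa using h7

/-- The analysis operator of a frame. -/
noncomputable def IsFrame.analysis (h : IsFrame 𝕜 ψ A B) : H →L[𝕜] lp (fun _ : ℕ => 𝕜) 2 :=
  LinearMap.mkContinuous
    { toFun := fun u => ⟨fun j => inner 𝕜 (ψ j) u, by
        refine memℓp_gen ?_
        simpa using (h.2.2 u).1⟩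
      map_add' := fun u v => by ext j; exact inner_add_right _ _ _
      map_smul' := fun a u => by ext j; exact inner_smul_right _ _ _ }
    (Real.sqrt B) (fun u => by
      refine abs_le_of_sq_le_sq' ?_ (by positivity) |>.2
      rw [mul_pow, Real.sq_sqrt h.2.1.le]
      have := lp.norm_rpow_eq_tsum (p := 2) (by norm_num)
        (⟨fun j => inner 𝕜 (ψ j) u, by
          refine memℓp_gen ?_
          simpa using (h.2.2 u).1⟩ : lp (fun _ : ℕ => 𝕜) 2)
      simp only [ENNReal.toReal_ofNat, Real.rpow_ofNat] at this
      exact this.trans_le (h.2.2 u).2.2)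

theorem IsFrame.analysis_apply (h : IsFrame 𝕜 ψ A B) (u : H) (j : ℕ) :
    h.analysis u j = inner 𝕜 (ψ j) u := rfl

/-- S = T*T for the analysis operator T: since T* sends the j-th unit vector of ℓ² to ψ j, it maps
the unit-vector expansion of Tu to the frame expansion. -/
theorem IsFrame.exists_frameOperator [CompleteSpace H] (h : IsFrame 𝕜 ψ A B) :
    ∃ S : H →L[𝕜] H, IsFrameOperator 𝕜 ψ S := by
  classical
  refine ⟨(ContinuousLinearMap.adjoint h.analysis) ∘L h.analysis, fun u => ?_⟩
  have h1 := (lp.hasSum_single (E := fun _ : ℕ => 𝕜) (p := 2) (by norm_num) (h.analysis u)).mapL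
    (ContinuousLinearMap.adjoint h.analysis)
  rw [ContinuousLinearMap.comp_apply]
  convert h1 using 2 with j
  refine ext_inner_right 𝕜 fun v => ?_
  rw [ContinuousLinearMap.adjoint_inner_left, lp.inner_single_left, h.analysis_apply,
    h.analysis_apply, inner_smul_left]
  simp [mul_comm]

theorem IsFrame.exists_frameOperator_equiv [CompleteSpace H] (h : IsFrame 𝕜 ψ A B) :
    ∃ S : H ≃L[𝕜] H, IsFrameOperator 𝕜 ψ (S : H →L[𝕜] H) := by
  obtain ⟨S, hS⟩ := h.exists_frameOperator
  have hB : ((B⁻¹ : ℝ) : 𝕜) ≠ 0 := by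
    have := h.2.1
    simpa using this.ne'
  have h1 := isUnit_one_sub_of_norm_lt_one (h.norm_one_sub_frameOperator_lt_one hS)
  rw [sub_sub_cancel] at h1
  have h2 : IsUnit S := by
    have := h1.smul (Units.mk0 _ hB)⁻¹
    rwa [Units.smul_def, Units.val_inv_eq_inv_val, Units.val_mk0, smul_smul,
      inv_mul_cancel₀ hB, one_smul] at this
  obtain ⟨U, rfl⟩ := h2
  exact ⟨ContinuousLinearEquiv.ofUnit U, hS⟩

end FrameOperator

end CasazzaChristensen


namespace CasazzaChristensen

/-! ### The inverse frame operator preserves polynomial decay -/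

section Localization

variable {𝕜 : Type*} [RCLike 𝕜] {H : Type*} [NormedAddCommGroup H] [InnerProductSpace 𝕜 H]

/-- The frame coefficients of `u` decay polynomially away from the index `l`. -/
def DecaysAt (𝕜 : Type*) [RCLike 𝕜] {H : Type*} [NormedAddCommGroup H] [InnerProductSpace 𝕜 H]
    (ψ : ℕ → H) (s : ℝ) (l : ℕ) (a : ℝ) (u : H) : Prop :=
  ∀ j, ‖inner 𝕜 (ψ j) u‖ ≤ a * decayWeight s j l

/-- The matrix of `W` with respect to `ψ` decays polynomially off its diagonal. -/
def OpDecays (ψ : ℕ → H) (s : ℝ) (a : ℝ) (W : H →L[𝕜] H) : Prop :=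
  ∀ l, DecaysAt 𝕜 ψ s l a (W (ψ l))

variable {ψ : ℕ → H} {s t a b : ℝ} {l : ℕ} {u v : H} {S Si R W : H →L[𝕜] H}

theorem DecaysAt.mono (h : DecaysAt 𝕜 ψ s l a u) (hab : a ≤ b) : DecaysAt 𝕜 ψ s l b u :=
  fun j => (h j).trans (mul_le_mul_of_nonneg_right hab (decayWeight_pos s j l).le)

theorem DecaysAt.sub (hu : DecaysAt 𝕜 ψ s l a u) (hv : DecaysAt 𝕜 ψ s l b v) :
    DecaysAt 𝕜 ψ s l (a + b) (u - v) := fun j => by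
  rw [inner_sub_right, add_mul]
  exact (norm_sub_le _ _).trans (add_le_add (hu j) (hv j))

theorem DecaysAt.smul (hu : DecaysAt 𝕜 ψ s l a u) (α : 𝕜) :
    DecaysAt 𝕜 ψ s l (‖α‖ * a) (α • u) := fun j => by
  rw [inner_smul_right, norm_mul, mul_assoc]
  exact mul_le_mul_of_nonneg_left (hu j) (norm_nonneg _)

theorem DecaysAt.nonneg (hu : DecaysAt 𝕜 ψ s l a u) : 0 ≤ a :=
  nonneg_of_mul_nonneg_left ((norm_nonneg _).trans (hu 0)) (decayWeight_pos s 0 l)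

/-- Expanding S v in the frame makes the coefficients of W(S v) a matrix-vector product. The S in
the middle is essential: a redundant frame gives no such formula for W v. -/
theorem DecaysAt.comp (hS : IsFrameOperator 𝕜 ψ S) (hs : 0 ≤ s) (ht0 : 0 ≤ t) (ht1 : t ≤ 1)
    (hst : 1 < s * (1 - t)) {ε δ : ℝ} (hW : OpDecays ψ s a W)
    (hε : ∀ i j, ‖inner 𝕜 (ψ j) (W (ψ i))‖ ≤ ε) (hv : DecaysAt 𝕜 ψ s l b v)
    (hδ : ∀ i, ‖inner 𝕜 (ψ i) v‖ ≤ δ) :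
    DecaysAt 𝕜 ψ s l (2 ^ s * decaySum (s * (1 - t)) *
        (a * (δ ^ t * b ^ (1 - t)) + b * (ε ^ t * a ^ (1 - t)))) (W (S v)) := by
  intro j
  obtain ⟨g, hg, hle, hsum⟩ := exists_convolution_bound hs ht0 ht1 hst (j := j) (l := l)
    (x := fun i => ‖inner 𝕜 (ψ j) (W (ψ i))‖) (y := fun i => ‖inner 𝕜 (ψ i) v‖)
    (hW 0).nonneg hv.nonneg (fun _ => norm_nonneg _) (fun _ => norm_nonneg _)
    (fun i => hW i j) (fun i => hε i j) hv hδ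
  have h1 : HasSum (fun i => (inner 𝕜 (ψ j) (W ((inner 𝕜 (ψ i) v : 𝕜) • ψ i)) : 𝕜))
      (inner 𝕜 (ψ j) (W (S v))) := ((hS v).mapL W).mapL (innerSL 𝕜 (ψ j))
  rw [← h1.tsum_eq]
  refine (tsum_of_norm_bounded hg.hasSum fun i => ?_).trans hsum
  rw [map_smul, inner_smul_right, norm_mul, mul_comm]
  exact hle i

theorem DecaysAt.comp_le (hS : IsFrameOperator 𝕜 ψ S) (hs : 0 ≤ s) (ht0 : 0 ≤ t) (ht1 : t ≤ 1)
    (hst : 1 < s * (1 - t)) (hW : OpDecays ψ s a W) (hv : DecaysAt 𝕜 ψ s l b v) :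
    DecaysAt 𝕜 ψ s l (2 ^ s * decaySum (s * (1 - t)) * 2 * a * b) (W (S v)) := by
  have ha := (hW 0).nonneg
  have hb := hv.nonneg
  have hpow : ∀ x : ℝ, 0 ≤ x → x ^ t * x ^ (1 - t) = x := fun x hx => by
    rw [← Real.rpow_add_of_nonneg hx ht0 (by linarith)]; simp
  refine (DecaysAt.comp hS hs ht0 ht1 hst hW (ε := a) (fun i j => ?_) hv (δ := b)
    (fun i => ?_)).mono (le_of_eq ?_)
  · exact (hW i j).trans (mul_le_of_le_one_right ha (decayWeight_le_one hs _ _))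
  · exact (hv i).trans (mul_le_of_le_one_right hb (decayWeight_le_one hs _ _))
  · rw [hpow a ha, hpow b hb]; ring

theorem norm_pow_apply_le {q : ℝ} (hq : ‖R‖ ≤ q) (k : ℕ) (u : H) :
    ‖(R ^ k) u‖ ≤ q ^ k * ‖u‖ := by
  induction k with
  | zero => simp
  | succ k ih =>
    rw [pow_succ', mul_apply_eq_comp]
    calc _ ≤ q * ‖(R ^ k) u‖ := R.le_of_opNorm_le hq _
      _ ≤ q * (q ^ k * ‖u‖) := mul_le_mul_of_nonneg_left ih ((norm_nonneg _).trans hq)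
      _ = _ := by ring

/-- Summing a geometrically decaying orbit preserves the decay of the frame coefficients. -/
theorem DecaysAt.of_one_sub_apply {Y : H →L[𝕜] H} {C σ : ℝ} {z z' : H}
    (hσ0 : 0 ≤ σ) (hσ1 : σ < 1)
    (hY : Tendsto (fun k : ℕ => (Y ^ k) z') atTop (𝓝 0)) (hz : (1 - Y) z' = z)
    (h : ∀ k : ℕ, DecaysAt 𝕜 ψ s l (C * σ ^ k) ((Y ^ k) z)) (k : ℕ) :
    DecaysAt 𝕜 ψ s l (C / (1 - σ) * σ ^ k) ((Y ^ k) z') := by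
  intro j
  set w := decayWeight s j l with hw
  have hC : 0 ≤ C := by simpa using (h 0).nonneg
  have hw0 : 0 ≤ w := (decayWeight_pos s j l).le
  have hσ : 0 < 1 - σ := by linarith
  have hstep : ∀ i : ℕ, (Y ^ i) z' = (Y ^ i) z + (Y ^ (i + 1)) z' := fun i => by
    rw [← hz, sub_apply, map_sub, one_apply_eq_self, pow_succ,
      mul_apply_eq_comp]
    abel
  -- Unrolls Y^k z' = ∑_{i<N} Y^(k+i) z + Y^(k+N) z'. All k are treated, not just k = 0, so that the
  -- conclusion can serve as hypothesis of a second application.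
  have hfin : ∀ N : ℕ, ‖inner 𝕜 (ψ j) ((Y ^ k) z')‖ ≤
      C * w * σ ^ k * (1 - σ ^ N) / (1 - σ) + ‖inner 𝕜 (ψ j) ((Y ^ (k + N)) z')‖ := by
    intro N
    induction N with
    | zero => simp
    | succ N ih =>
      have h1 : ‖inner 𝕜 (ψ j) ((Y ^ (k + N)) z')‖ ≤
          C * σ ^ (k + N) * w + ‖inner 𝕜 (ψ j) ((Y ^ (k + (N + 1))) z')‖ := by
        rw [hstep, inner_add_right]
        exact (norm_add_le _ _).trans (add_le_add (h _ j) le_rfl)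
      refine ih.trans ((add_le_add_right h1 _).trans (le_of_eq ?_))
      rw [← add_assoc]
      congr 1
      field_simp
      ring
  have hlim : Tendsto (fun N : ℕ => C * w * σ ^ k * (1 - σ ^ N) / (1 - σ) +
      ‖inner 𝕜 (ψ j) ((Y ^ (k + N)) z')‖) atTop
      (𝓝 (C * w * σ ^ k * (1 - 0) / (1 - σ) + ‖(inner 𝕜 (ψ j) (0 : H) : 𝕜)‖)) := by
    refine Tendsto.add ?_ ?_
    · exact (((tendsto_pow_atTop_nhds_zero_of_lt_one hσ0 hσ1).const_sub 1).const_mul _).div_const _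
    · have h2 : Tendsto (fun N : ℕ => (Y ^ (k + N)) z') atTop (𝓝 0) :=
        hY.comp (tendsto_atTop_mono (fun N => Nat.le_add_left N k) tendsto_id)
      exact (tendsto_const_nhds.inner h2).norm
  refine (ge_of_tendsto' hlim hfin).trans (le_of_eq ?_)
  rw [inner_zero_right, norm_zero]
  field_simp
  ring

/-- The Newton iterates for the inverse of `S` with residuals `R ^ (2 ^ i)`. -/
def newtonIterate (R Si : H →L[𝕜] H) (i : ℕ) : H →L[𝕜] H := (1 - R ^ (2 ^ i)) * Si

theorem newtonIterate_mul (h : Si * S = 1) (i : ℕ) :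
    newtonIterate R Si i * S = 1 - R ^ (2 ^ i) := by
  rw [newtonIterate, mul_assoc, h, mul_one]

theorem newtonIterate_zero {α : 𝕜} (hR : R = 1 - α • S) (h : S * Si = 1) :
    newtonIterate R Si 0 = α • 1 := by
  rw [newtonIterate, pow_zero, pow_one, hR, sub_sub_cancel, smul_mul_assoc, h]

/-- With X = R^(2^i) this is 1 - X² = 2(1 - X) - (1 - X)². Unlike the definition, the recursion does
not mention `Si`, so decay can be propagated through it. -/
theorem newtonIterate_succ (h : Si * S = 1) (i : ℕ) :
    newtonIterate R Si (i + 1) =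
      (2 : 𝕜) • newtonIterate R Si i - newtonIterate R Si i * S * newtonIterate R Si i := by
  rw [newtonIterate_mul h, newtonIterate, newtonIterate, pow_succ 2 i, pow_mul, sq, two_smul]
  noncomm_ring

theorem norm_newtonIterate_apply_le (hR : ‖R‖ ≤ 1) (i : ℕ) (u : H) :
    ‖newtonIterate R Si i u‖ ≤ 2 * ‖Si‖ * ‖u‖ := by
  have h1 := norm_pow_apply_le hR (2 ^ i) (Si u)
  rw [one_pow, one_mul] at h1
  have h2 := Si.le_opNorm u
  have h3 : newtonIterate R Si i u = Si u - (R ^ (2 ^ i)) (Si u) := rfl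
  rw [h3]
  linarith [norm_sub_le (Si u) ((R ^ (2 ^ i)) (Si u))]

/-- Inverse-closedness for localized frames: if the matrix of a frame decays polynomially off
the diagonal, then the inverse of the frame operator preserves polynomial decay of frame
coefficients, with the same exponent. -/
theorem DecaysAt.inverse_frameOperator {c₀ : ℝ} (hs : 1 < s) (hloc : IsSelfLocalized 𝕜 ψ c₀ s)
    (hS : IsFrameOperator 𝕜 ψ S) {α : 𝕜} (hR : ‖1 - α • S‖ < 1)
    (hl : Si * S = 1) (hr : S * Si = 1) (hu : DecaysAt 𝕜 ψ s l b u) :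
    ∃ b', DecaysAt 𝕜 ψ s l b' (Si u) := by
  set R := 1 - α • S with hRdef
  -- Chosen so that s(1 - t) = (s + 1)/2 > 1.
  set t := (s - 1) / (2 * s) with htdef
  have hs0 : 0 < s := by linarith
  have ht0 : 0 < t := by apply div_pos <;> linarith
  have ht1 : t < 1 := by rw [htdef, div_lt_one (by linarith)]; linarith
  have hst : 1 < s * (1 - t) := by
    have : s * (1 - t) = (s + 1) / 2 := by rw [htdef]; field_simp; ring
    linarith
  obtain ⟨hc₀, hloc⟩ := hloc
  set K := 2 ^ s * decaySum (s * (1 - t)) with hK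
  have hK0 : 0 ≤ K := mul_nonneg (by positivity) (decaySum_nonneg _)
  have hone : OpDecays ψ s c₀ (1 : H →L[𝕜] H) := fun l j => by
    have := hloc l j
    rw [abs_sub_comm] at this
    exact this
  set N := 1 + c₀ with hN
  have hψ : ∀ j, ‖ψ j‖ ≤ N := fun j => by
    have h1 := hloc j j
    simp only [sub_self, abs_zero, add_zero, Real.one_rpow, mul_one] at h1
    rw [inner_self_eq_norm_sq_to_K, norm_pow, RCLike.norm_ofReal, sq_abs] at h1
    nlinarith [norm_nonneg (ψ j)]
  have hN0 : 0 ≤ N := by linarith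
  have hinner : ∀ j (x : H), ‖inner 𝕜 (ψ j) x‖ ≤ N * ‖x‖ := fun j x =>
    (norm_inner_le_norm _ _).trans (mul_le_mul_of_nonneg_right (hψ j) (norm_nonneg _))
  set M := 2 * ‖Si‖ with hM
  set ε := N * (M * N) with hε
  have hε0 : 0 ≤ ε := by positivity
  have hGε : ∀ n i j, ‖inner 𝕜 (ψ j) (newtonIterate R Si n (ψ i))‖ ≤ ε := fun n i j => by
    refine (hinner j _).trans (mul_le_mul_of_nonneg_left ?_ hN0)
    exact (norm_newtonIterate_apply_le hR.le n _).trans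
      (mul_le_mul_of_nonneg_left (hψ i) (by positivity))
  obtain ⟨q, hRq, hq1⟩ : ∃ q, ‖R‖ < q ∧ q < 1 := exists_between hR
  have hq0 : 0 < q := (norm_nonneg _).trans_lt hRq
  -- Then β² q^t = q^(t/2) < 1: the gain q^t from the norm outweighs two losses of β.
  set β := q ^ (-(t / 4)) with hβdef
  have hβ : 1 < β := Real.one_lt_rpow_of_pos_of_lt_one_of_neg hq0 hq1 (by linarith)
  have hβq : β ^ 2 * q ^ t < 1 := by
    rw [hβdef, ← Real.rpow_natCast, ← Real.rpow_mul hq0.le, ← Real.rpow_add hq0]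
    exact Real.rpow_lt_one hq0.le hq1 (by push_cast; linarith)
  -- The entries of all Newton iterates are bounded by the same ε, which gives the exponent 2 - t.
  -- The quantity 1 + 2Ka, with D = 2K, is the factor by which X = 1 - GS enlarges decay constants.
  obtain ⟨n, a, ha, hGa, hγ⟩ := exists_subexponential (C := 1 + 2 + 2 * K * ε ^ t) (θ := 2 - t)
    (a₀ := ‖α‖ * c₀) (D := K * 2) (β := β) (by have : 0 ≤ 2 * K * ε ^ t := by positivity
                                               linarith)
    (by linarith) (by linarith) (by positivity) hβ
    (p := fun i a => OpDecays ψ s a (newtonIterate R Si i))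
    (fun a ha l => by
      rw [newtonIterate_zero hRdef hr]
      exact ((hone l).smul α).mono ha)
    (fun i a ha hG l => by
      rw [newtonIterate_succ hl]
      have h1 := DecaysAt.comp hS hs0.le ht0.le ht1.le hst hG (hGε i) (hG l) (hGε i l)
      refine (((hG l).smul (2 : 𝕜)).sub h1).mono ?_
      have hpow : a * a ^ (1 - t) = a ^ (2 - t) := by
        rw [← Real.rpow_one_add' (by linarith) (by linarith)]
        congr 1; ring
      have hage : a ≤ a ^ (2 - t) := Real.self_le_rpow_of_one_le ha (by linarith)
      have e : K * (a * (ε ^ t * a ^ (1 - t)) + a * (ε ^ t * a ^ (1 - t))) =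
          2 * K * ε ^ t * a ^ (2 - t) := by rw [← hpow]; ring
      rw [e, RCLike.norm_two]
      linarith)
  set γ := β ^ (2 ^ n) with hγdef
  set Q := q ^ (2 ^ n) with hQdef
  set G := newtonIterate R Si n with hG
  set X := R ^ (2 ^ n) with hX
  have hγ1 : 1 ≤ γ := one_le_pow₀ hβ.le
  have hQ0 : 0 < Q := by positivity
  set σ := γ ^ 2 * Q ^ t with hσ
  have hσ0 : 0 ≤ σ := by positivity
  have hσ1 : σ < 1 := by
    have : σ = (β ^ 2 * q ^ t) ^ (2 ^ n) := by
      rw [hσ, hγdef, hQdef, mul_pow, pow_right_comm, ← Real.rpow_pow_comm hq0.le]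
    rw [this]
    exact pow_lt_one₀ (by positivity) hβq (by positivity)
  have hXn : ∀ (k : ℕ) (x : H), ‖(X ^ k) x‖ ≤ Q ^ k * ‖x‖ := fun k x => by
    rw [hX, ← pow_mul, hQdef, ← pow_mul]
    exact norm_pow_apply_le hRq.le _ _
  have hXS : ∀ x, X x = x - G (S x) := fun x => by
    have h1 : G * S = 1 - X := newtonIterate_mul hl n
    have h2 : X = 1 - G * S := by rw [h1]; abel
    rw [h2]; rfl
  have hXdec : ∀ {m : ℕ} {b : ℝ} {x : H}, DecaysAt 𝕜 ψ s m b x →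
      ∀ k : ℕ, DecaysAt 𝕜 ψ s m (γ ^ k * b) ((X ^ k) x) := by
    intro m b x hx k
    induction k with
    | zero => simpa using hx
    | succ k ih =>
      rw [pow_succ' X, mul_apply_eq_comp, hXS]
      refine (ih.sub (DecaysAt.comp_le hS hs0.le ht0.le ht1.le hst hGa ih)).mono ?_
      have h1 := mul_le_mul_of_nonneg_right hγ ih.nonneg
      calc _ = (1 + K * 2 * a) * (γ ^ k * b) := by ring
        _ ≤ γ * (γ ^ k * b) := h1
        _ = _ := by ring
  -- Both factors have decay constants of order γ^k and sup bounds of order Q^k. Interpolation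
  -- yields γ^k (γ^k)^(1-t) (Q^k)^t ≤ σ^k.
  have hsandwich : ∀ {b : ℝ} {x : H}, DecaysAt 𝕜 ψ s l b x → ∃ E, ∀ k : ℕ,
      DecaysAt 𝕜 ψ s l (E * σ ^ k) ((X ^ k) (S ((X ^ k) x))) := by
    intro b x hx
    have hb := hx.nonneg
    refine ⟨K * (c₀ * ((N * ‖x‖) ^ t * b ^ (1 - t)) +
      b * ((N * N) ^ t * c₀ ^ (1 - t))), fun k => ?_⟩
    have h1 := DecaysAt.comp hS hs0.le ht0.le ht1.le hst (W := X ^ k)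
      (fun m => hXdec (hone m) k) (ε := N * N * Q ^ k)
      (fun i j => (hinner j _).trans (by
        rw [mul_assoc]
        refine mul_le_mul_of_nonneg_left ?_ hN0
        have := mul_le_mul_of_nonneg_left (hψ i) (show 0 ≤ Q ^ k by positivity)
        linarith [hXn k (ψ i)])) (hXdec hx k) (δ := N * ‖x‖ * Q ^ k)
      (fun i => (hinner i _).trans (by
        have := mul_le_mul_of_nonneg_left (hXn k x) hN0
        linarith))
    refine h1.mono ?_
    have hγk : 1 ≤ γ ^ k := one_le_pow₀ hγ1
    have hγk0 : 0 ≤ γ ^ k := by linarith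
    have hγt : (γ ^ k) ^ (1 - t) ≤ γ ^ k := Real.rpow_le_self_of_one_le hγk (by linarith)
    have hterm : ∀ x y z : ℝ, 0 ≤ x → 0 ≤ y → 0 ≤ z →
        γ ^ k * x * ((y * Q ^ k) ^ t * (γ ^ k * z) ^ (1 - t)) ≤
          x * (y ^ t * z ^ (1 - t)) * σ ^ k := by
      intro x y z hx hy hz
      rw [Real.mul_rpow hy (by positivity), Real.mul_rpow hγk0 hz, hσ, mul_pow,
        Real.rpow_pow_comm hQ0.le]
      calc _ = x * (y ^ t * z ^ (1 - t)) * (γ ^ k * (γ ^ k) ^ (1 - t) * (Q ^ k) ^ t) := by ring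
        _ ≤ x * (y ^ t * z ^ (1 - t)) * (γ ^ k * γ ^ k * (Q ^ k) ^ t) := by gcongr
        _ = _ := by ring
    have h2 := hterm c₀ (N * ‖x‖) b hc₀.le (by positivity) hb
    have h3 := hterm b (N * N) c₀ hb (by positivity) hc₀.le
    calc _ ≤ K * (c₀ * ((N * ‖x‖) ^ t * b ^ (1 - t)) * σ ^ k +
          b * ((N * N) ^ t * c₀ ^ (1 - t)) * σ ^ k) :=
          mul_le_mul_of_nonneg_left (add_le_add h2 h3) hK0
      _ = _ := by ring
  -- `OpDecays` controls only G(S v). For G v itself the Newton recursion is unfolded down to α • 1;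
  -- the constants need not be tracked.
  have hGex : ∀ (i : ℕ) {b : ℝ} {x : H}, DecaysAt 𝕜 ψ s l b x →
      ∃ b', DecaysAt 𝕜 ψ s l b' (newtonIterate R Si i x) := by
    have hSdec : ∀ {b : ℝ} {x : H}, DecaysAt 𝕜 ψ s l b x → ∃ b', DecaysAt 𝕜 ψ s l b' (S x) :=
      fun hx => ⟨_, DecaysAt.comp_le hS hs0.le ht0.le ht1.le hst hone hx⟩
    intro i
    induction i with
    | zero =>
      intro b x hx
      rw [newtonIterate_zero hRdef hr]
      exact ⟨_, hx.smul α⟩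
    | succ i ih =>
      intro b x hx
      rw [newtonIterate_succ hl]
      obtain ⟨b₁, h1⟩ := ih hx
      obtain ⟨b₂, h2⟩ := hSdec h1
      obtain ⟨b₃, h3⟩ := ih h2
      exact ⟨_, (h1.smul (2 : 𝕜)).sub h3⟩
  set Y := X ^ 2 with hY
  have hG' : newtonIterate R Si (n + 1) = (1 - Y) * Si := by
    rw [newtonIterate, hY, hX, ← pow_mul, pow_succ 2 n]
  obtain ⟨b₁, hb₁⟩ := hGex (n + 1) hu
  obtain ⟨b₂, hb₂⟩ := hGex (n + 1) hb₁
  rw [hG'] at hb₂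
  obtain ⟨E, hE⟩ := hsandwich hb₂
  have hRS : Commute R S := by
    rw [hRdef]
    exact (Commute.one_left S).sub_left ((Commute.refl S).smul_left α)
  have hXScomm : Commute X S := hRS.pow_left _
  have hYS : Commute Y S := hXScomm.pow_left _
  have hYtend : ∀ x, Tendsto (fun k : ℕ => (Y ^ k) x) atTop (𝓝 0) := fun x => by
    have hQ1 : Q < 1 := pow_lt_one₀ hq0.le hq1 (by positivity)
    have h1 : Tendsto (fun k : ℕ => Q ^ (2 * k) * ‖x‖) atTop (𝓝 (0 * ‖x‖)) := by
      refine Tendsto.mul_const _ ?_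
      simp_rw [pow_mul]
      exact tendsto_pow_atTop_nhds_zero_of_lt_one (by positivity)
        (pow_lt_one₀ hQ0.le hQ1 two_ne_zero)
    rw [zero_mul] at h1
    refine squeeze_zero_norm (fun k => ?_) h1
    rw [hY, ← pow_mul]
    exact hXn _ _
  have hsplit : ∀ k : ℕ, (X ^ k) * S * (X ^ k) = Y ^ k * S := fun k => by
    rw [mul_assoc, ← (hXScomm.pow_left k).eq, ← mul_assoc, ← pow_add, hY, ← pow_mul X, two_mul]
  -- The right side has the leading S that `hsandwich` needs, and (1 - Y) Si is the next Newton
  -- iterate. Inverting 1 - Y twice by Neumann series then recovers `Si u`.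
  have hfactor : (1 - Y) * ((1 - Y) * Si) = S * (((1 - Y) * Si) * ((1 - Y) * Si)) := by
    have hc : Commute (1 - Y) S := (Commute.one_left S).sub_left hYS
    rw [mul_assoc (1 - Y) Si, ← mul_assoc S, ← hc.eq, mul_assoc (1 - Y) S, ← mul_assoc S Si,
      hr, one_mul]
  have hYdec : ∀ k : ℕ, DecaysAt 𝕜 ψ s l (E * σ ^ k)
      ((Y ^ k) (S (((1 - Y) * Si) (((1 - Y) * Si) u)))) := fun k => by
    have e := congrArg (fun T : H →L[𝕜] H => T (((1 - Y) * Si) (((1 - Y) * Si) u))) (hsplit k)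
    exact (show (X ^ k) (S ((X ^ k) (((1 - Y) * Si) (((1 - Y) * Si) u)))) = _ from e) ▸ hE k
  have h1 := DecaysAt.of_one_sub_apply (z' := ((1 - Y) * Si) u) hσ0 hσ1 (hYtend _)
    (congrArg (fun T : H →L[𝕜] H => T u) hfactor) hYdec
  have h2 := DecaysAt.of_one_sub_apply (z' := Si u) hσ0 hσ1 (hYtend _) rfl h1 0
  exact ⟨_, h2⟩

end Localization

end CasazzaChristensen


namespace CasazzaChristensen

/-! ### Gram eigenvalues and the lower frame bound from finitely many coefficients -/

section Gram

variable {𝕜 : Type*} [RCLike 𝕜] {H : Type*} [NormedAddCommGroup H] [InnerProductSpace 𝕜 H]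

/-- The Rayleigh bound for the smallest eigenvalue of a Hermitian matrix. -/
theorem iInf_eigenvalues_mul_sum_sq_le {ι : Type*} [Fintype ι] [DecidableEq ι]
    {M : Matrix ι ι 𝕜} (hM : M.IsHermitian) (a : ι → 𝕜) :
    (⨅ i, hM.eigenvalues i) * ∑ i, ‖a i‖ ^ 2 ≤ RCLike.re (star a ⬝ᵥ M.mulVec a) := by
  set x : EuclideanSpace 𝕜 ι := WithLp.toLp 2 a with hx
  have hsymm := Matrix.isSymmetric_toEuclideanLin_iff.2 hM
  have hb : ∀ i, Matrix.toEuclideanLin M (hM.eigenvectorBasis i) =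
      (hM.eigenvalues i : 𝕜) • hM.eigenvectorBasis i := fun i => by
    ext j
    have := congrFun (hM.mulVec_eigenvectorBasis i) j
    rw [Pi.smul_apply, RCLike.real_smul_eq_coe_smul (K := 𝕜)] at this
    exact this
  have h1 : star a ⬝ᵥ M.mulVec a = inner 𝕜 x (Matrix.toEuclideanLin M x) := by
    rw [EuclideanSpace.inner_eq_star_dotProduct, dotProduct_comm]
    rfl
  have h2 : RCLike.re (inner 𝕜 x (Matrix.toEuclideanLin M x)) =
      ∑ i, hM.eigenvalues i * ‖inner 𝕜 (hM.eigenvectorBasis i) x‖ ^ 2 := by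
    rw [← hM.eigenvectorBasis.sum_inner_mul_inner, map_sum]
    refine Finset.sum_congr rfl fun i _ => ?_
    rw [← hsymm, hb, inner_smul_left, RCLike.conj_ofReal, mul_left_comm, RCLike.re_ofReal_mul,
      ← inner_conj_symm x, RCLike.conj_mul]
    norm_cast
  have h3 : ∑ i, ‖a i‖ ^ 2 = ∑ i, ‖inner 𝕜 (hM.eigenvectorBasis i) x‖ ^ 2 := by
    rw [hM.eigenvectorBasis.sum_sq_norm_inner_right, EuclideanSpace.norm_sq_eq]
  rw [h1, h2, h3, Finset.mul_sum]
  exact Finset.sum_le_sum fun i _ => mul_le_mul_of_nonneg_right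
    (ciInf_le (Set.finite_range _).bddBelow i) (by positivity)

theorem gramMinEigenvalue_mul_sum_sq_le (ψ : ℕ → H) {n : ℕ} (J : Finset (Fin n)) (a : J → 𝕜) :
    gramMinEigenvalue 𝕜 ψ n J * ∑ i, ‖a i‖ ^ 2 ≤ ‖∑ i, a i • ψ (i : Fin n)‖ ^ 2 := by
  refine (iInf_eigenvalues_mul_sum_sq_le (gramSubmatrix_isHermitian 𝕜 ψ n J) a).trans_eq ?_
  have : gramSubmatrix 𝕜 ψ n J = Matrix.gram 𝕜 fun i : J => ψ (i : Fin n) := rfl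
  rw [this, Matrix.star_dotProduct_gram_mulVec, inner_self_eq_norm_sq]

open scoped ComplexOrder in
theorem IsGramCore.gramMinEigenvalue_pos {ψ : ℕ → H} {n : ℕ} {J : Finset (Fin n)}
    (hJ : IsGramCore 𝕜 ψ n J) (hne : J.Nonempty) : 0 < gramMinEigenvalue 𝕜 ψ n J := by
  have : Nonempty J := hne.to_subtype
  have hps : (gramSubmatrix 𝕜 ψ n J).PosSemidef := (Matrix.posSemidef_gram 𝕜 _).submatrix _
  obtain ⟨i, hi⟩ := exists_eq_ciInf_of_finite
    (f := (gramSubmatrix_isHermitian 𝕜 ψ n J).eigenvalues)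
  rw [gramMinEigenvalue, ← hi]
  refine lt_of_le_of_ne (hps.eigenvalues_nonneg i) fun h0 => ?_
  have hdet := hJ.1
  rw [(gramSubmatrix_isHermitian 𝕜 ψ n J).det_eq_prod_eigenvalues,
    Finset.prod_eq_zero (Finset.mem_univ i) (by rw [← h0]; simp)] at hdet
  exact not_isUnit_zero hdet

/-- Frame coefficients beyond the block spanned by the first `n` frame elements. -/
theorem IsSelfLocalized.norm_inner_sq_le {ψ : ℕ → H} {c₀ s : ℝ} (hloc : IsSelfLocalized 𝕜 ψ c₀ s)
    (hs : 0 ≤ s) {n m : ℕ} (hnm : n ≤ m) (J : Finset (Fin n)) (a : J → 𝕜) (k : ℕ) :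
    ‖inner 𝕜 (ψ (k + m)) (∑ i, a i • ψ (i : Fin n))‖ ^ 2 ≤
      (∑ i, ‖a i‖ ^ 2) * (n * c₀ ^ 2) * (((m : ℝ) - n + 1) + 1 + k) ^ (-(2 * s)) := by
  -- Zero-based indices i ≤ n - 1 and k + m differ by at least k + m - n + 1; the weight adds
  -- another 1.
  set y : ℝ := ((m : ℝ) - n + 1) + 1 + k with hy
  have hnm' : (n : ℝ) ≤ m := by exact_mod_cast hnm
  have hk : (0 : ℝ) ≤ k := k.cast_nonneg
  have hy0 : 0 < y := by linarith
  have hentry : ∀ i : J, ‖inner 𝕜 (ψ (k + m)) (ψ (i : Fin n))‖ ≤ c₀ * y ^ (-s) := fun i => by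
    refine (hloc.2 _ _).trans (mul_le_mul_of_nonneg_left ?_ hloc.1.le)
    have hi : (((i : Fin n) : ℕ) : ℝ) + 1 ≤ n := by exact_mod_cast (i : Fin n).isLt
    refine Real.rpow_le_rpow_of_nonpos hy0 ?_ (by linarith)
    rw [abs_sub_comm]
    have := le_abs_self (((k + m : ℕ) : ℝ) - (((i : Fin n) : ℕ) : ℝ))
    push_cast at this ⊢
    linarith
  have h1 : ‖inner 𝕜 (ψ (k + m)) (∑ i, a i • ψ (i : Fin n))‖ ≤ ∑ i : J, ‖a i‖ * (c₀ * y ^ (-s)) := by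
    rw [inner_sum]
    refine (norm_sum_le _ _).trans (Finset.sum_le_sum fun i _ => ?_)
    rw [inner_smul_right, norm_mul]
    exact mul_le_mul_of_nonneg_left (hentry i) (norm_nonneg _)
  have h2 := Finset.sum_mul_sq_le_sq_mul_sq Finset.univ (fun i : J => ‖a i‖)
    (fun _ => c₀ * y ^ (-s))
  have h3 : (Fintype.card J : ℝ) ≤ n := by
    rw [Fintype.card_coe]
    exact_mod_cast (Finset.card_le_univ J).trans_eq (Fintype.card_fin n)
  have h4 : (y ^ (-s)) ^ 2 = y ^ (-(2 * s)) := by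
    rw [← Real.rpow_natCast, ← Real.rpow_mul hy0.le]
    congr 1; push_cast; ring
  have h5 : 0 ≤ ∑ i, ‖a i‖ ^ 2 := Finset.sum_nonneg fun _ _ => by positivity
  calc _ ≤ (∑ i : J, ‖a i‖ * (c₀ * y ^ (-s))) ^ 2 := pow_le_pow_left₀ (norm_nonneg _) h1 2
    _ ≤ _ := h2
    _ = (∑ i, ‖a i‖ ^ 2) * (Fintype.card J * c₀ ^ 2) * y ^ (-(2 * s)) := by
      rw [Finset.sum_const, Finset.card_univ, nsmul_eq_mul, mul_pow, h4]; ring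
    _ ≤ _ := by gcongr

theorem natCast_le_sampleSize {A c₀ s lam : ℝ} {n : ℕ} (hA : 0 ≤ A) (hs : 1 ≤ 2 * s)
    (hlam : 0 ≤ lam) : (n : ℝ) ≤ sampleSize A c₀ s lam n := by
  unfold sampleSize
  have : 0 ≤ 2 * s - 1 := by linarith
  have : 0 ≤ (2 * c₀ ^ 2 * (n : ℝ) / (A * (2 * s - 1) * lam)) ^ (1 / (2 * s - 1)) := by positivity
  linarith

/-- With `m` at least the sample size, the first `m` frame coefficients bound the norm from
below on the span of the first `n` frame elements. -/
theorem IsFrame.half_lower_bound_on_headSpan {ψ : ℕ → H} {A B c₀ s : ℝ} (h : IsFrame 𝕜 ψ A B)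
    (hloc : IsSelfLocalized 𝕜 ψ c₀ s) (hs : 1 < s) {n m : ℕ} (hn : 1 ≤ n) {J : Finset (Fin n)}
    (hJ : IsGramCore 𝕜 ψ n J) (hm : sampleSize A c₀ s (gramMinEigenvalue 𝕜 ψ n J) n ≤ m)
    {v : H} (hv : v ∈ headSpan 𝕜 ψ n) :
    A / 2 * ‖v‖ ^ 2 ≤ ∑ j ∈ Finset.range m, ‖inner 𝕜 (ψ j) v‖ ^ 2 := by
  rw [← hJ.2, Submodule.mem_span_range_iff_exists_fun] at hv
  obtain ⟨a, rfl⟩ := hv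
  rcases J.eq_empty_or_nonempty with rfl | hne
  · simp
  set lam := gramMinEigenvalue 𝕜 ψ n J with hlamdef
  have hlam : 0 < lam := hJ.gramMinEigenvalue_pos hne
  have hA := h.1
  have hc := hloc.1
  have hn' : (0 : ℝ) < n := by exact_mod_cast hn
  have hnm : n ≤ m := by
    exact_mod_cast (natCast_le_sampleSize hA.le (by linarith) hlam.le).trans hm
  have hnm' : (n : ℝ) ≤ m := by exact_mod_cast hnm
  set v := ∑ i, a i • ψ (i : Fin n) with hv
  set E := ∑ i, ‖a i‖ ^ 2 with hE
  have hE0 : 0 ≤ E := Finset.sum_nonneg fun _ _ => by positivity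
  have hray : lam * E ≤ ‖v‖ ^ 2 := gramMinEigenvalue_mul_sum_sq_le ψ J a
  set r := 2 * s - 1 with hr
  have hr0 : 0 < r := by linarith
  set x : ℝ := (m : ℝ) - n + 1 with hx
  have hx0 : 0 < x := by linarith
  -- The bracket of the sample size, tuned so that the tail bound E n c₀² b⁻¹ / r equals (A/2) lam
  -- E, which the Rayleigh bound `hray` absorbs into (A/2)‖v‖².
  set b := 2 * c₀ ^ 2 * (n : ℝ) / (A * r * lam) with hb
  have hb0 : 0 < b := by positivity
  have hbx : b ≤ x ^ r := by
    have h1 : b ^ (1 / r) ≤ x := by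
      have : (n : ℝ) + b ^ (1 / r) ≤ m := hm
      linarith
    have h2 := Real.rpow_le_rpow (by positivity) h1 hr0.le
    rwa [← Real.rpow_mul hb0.le, one_div_mul_cancel hr0.ne', Real.rpow_one] at h2
  have htail : ∑' k, ‖inner 𝕜 (ψ (k + m)) v‖ ^ 2 ≤ A / 2 * ‖v‖ ^ 2 := by
    have h1 := tsum_le_of_le_rpow_neg_shift (r := 2 * s) (x := x) (D := E * (n * c₀ ^ 2))
      (by linarith) hx0 (by positivity) (fun k => by positivity)
      (fun k => hloc.norm_inner_sq_le (by linarith) hnm J a k)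
    refine h1.trans ?_
    have h2 : x ^ (-r) ≤ b⁻¹ := by
      rw [Real.rpow_neg hx0.le]
      exact inv_anti₀ hb0 hbx
    calc E * (n * c₀ ^ 2) * (x ^ (-r) / r) ≤ E * (n * c₀ ^ 2) * (b⁻¹ / r) := by gcongr
      _ = A / 2 * (lam * E) := by rw [hb]; field_simp
      _ ≤ _ := by gcongr
  have hsplit := (h.2.2 v).1.sum_add_tsum_nat_add m
  have hlow := (h.2.2 v).2.1
  linarith

end Gram

/-! ### Invertibility of the compressions and truncation errors -/

section FiniteSection

variable {𝕜 : Type*} [RCLike 𝕜] {H : Type*} [NormedAddCommGroup H] [InnerProductSpace 𝕜 H]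
variable {ψ : ℕ → H}

theorem compressedOp_apply (n m : ℕ) (v : headSpan 𝕜 ψ n) :
    compressedOp 𝕜 ψ n m v = headProj 𝕜 ψ n (partialFrameOp 𝕜 ψ m v) := rfl

theorem norm_headProj_le (n : ℕ) (x : H) : ‖headProj 𝕜 ψ n x‖ ≤ ‖x‖ :=
  Submodule.norm_orthogonalProjectionOnto_apply_le _ _

theorem partialFrameOp_mem_headSpan (n : ℕ) (x : H) :
    partialFrameOp 𝕜 ψ n x ∈ headSpan 𝕜 ψ n := by
  rw [partialFrameOp_apply]
  refine Submodule.sum_mem _ fun j hj => Submodule.smul_mem _ _ (Submodule.subset_span ?_)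
  exact ⟨⟨j, Finset.mem_range.1 hj⟩, rfl⟩

theorem re_inner_compressedOp (n m : ℕ) (v : headSpan 𝕜 ψ n) :
    RCLike.re (inner 𝕜 v (compressedOp 𝕜 ψ n m v) : 𝕜) =
      ∑ j ∈ Finset.range m, ‖inner 𝕜 (ψ j) (v : H)‖ ^ 2 := by
  rw [compressedOp_apply, headProj, Submodule.inner_orthogonalProjectionOnto_eq_of_mem_left,
    partialFrameOp_apply, inner_sum, map_sum]
  refine Finset.sum_congr rfl fun j _ => ?_
  rw [inner_smul_right, ← inner_conj_symm (v : H), RCLike.mul_conj]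
  norm_cast

theorem norm_le_norm_compressedOp {A : ℝ} {n m : ℕ} (v : headSpan 𝕜 ψ n)
    (h : A / 2 * ‖(v : H)‖ ^ 2 ≤ ∑ j ∈ Finset.range m, ‖inner 𝕜 (ψ j) (v : H)‖ ^ 2) :
    A / 2 * ‖v‖ ≤ ‖compressedOp 𝕜 ψ n m v‖ := by
  rw [← re_inner_compressedOp] at h
  have h1 : RCLike.re (inner 𝕜 v (compressedOp 𝕜 ψ n m v) : 𝕜) ≤
      ‖v‖ * ‖compressedOp 𝕜 ψ n m v‖ := re_inner_le_norm _ _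
  rcases (norm_nonneg v).eq_or_lt with h0 | h0
  · rw [← h0, mul_zero]; exact norm_nonneg _
  · refine le_of_mul_le_mul_left ?_ h0
    calc ‖v‖ * (A / 2 * ‖v‖) = A / 2 * ‖(v : H)‖ ^ 2 := by rw [Submodule.coe_norm]; ring
      _ ≤ _ := h.trans h1

/-- Bounded below implies injective, which suffices because H_n is finite-dimensional. -/
theorem exists_compressedOp_equiv {A : ℝ} (hA : 0 < A) {n m : ℕ}
    (h : ∀ v : headSpan 𝕜 ψ n, A / 2 * ‖v‖ ≤ ‖compressedOp 𝕜 ψ n m v‖) :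
    ∃ V : headSpan 𝕜 ψ n ≃L[𝕜] headSpan 𝕜 ψ n,
      (V : headSpan 𝕜 ψ n →L[𝕜] headSpan 𝕜 ψ n) = compressedOp 𝕜 ψ n m := by
  have hinj : Function.Injective
      (compressedOp 𝕜 ψ n m : headSpan 𝕜 ψ n →ₗ[𝕜] headSpan 𝕜 ψ n) := by
    refine (injective_iff_map_eq_zero _).2 fun v hv => ?_
    have h1 := h v
    rw [show compressedOp 𝕜 ψ n m v = 0 from hv, norm_zero] at h1
    exact norm_le_zero_iff.1 (by nlinarith [norm_nonneg v])
  exact ⟨(LinearEquiv.ofInjectiveEndo _ hinj).toContinuousLinearEquiv, by ext v; rfl⟩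

/-- The error of a partial frame expansion of a vector with decaying frame coefficients. -/
theorem IsFrame.norm_sub_partialFrameOp_le {A B s b : ℝ} (h : IsFrame 𝕜 ψ A B) (hs : 1 < s)
    {S : H →L[𝕜] H} (hS : IsFrameOperator 𝕜 ψ S) {u : H} (hu : DecaysAt 𝕜 ψ s 0 b u)
    {n m : ℕ} (hn : 1 ≤ n) (hnm : n ≤ m) :
    ‖S u - partialFrameOp 𝕜 ψ m u‖ ≤
      Real.sqrt (B / (2 * s - 1)) * b * (n : ℝ) ^ (-(s - 1 / 2)) := by
  have hb := hu.nonneg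
  have hB := h.2.1
  have hn' : (0 : ℝ) < n := by exact_mod_cast hn
  have hm' : (0 : ℝ) < m := by exact_mod_cast hn.trans hnm
  have hnm' : (n : ℝ) ≤ m := by exact_mod_cast hnm
  have hr : 0 < 2 * s - 1 := by linarith
  have htail : ∑' k, ‖inner 𝕜 (ψ (k + m)) u‖ ^ 2 ≤
      b ^ 2 * ((m : ℝ) ^ (-(2 * s - 1)) / (2 * s - 1)) := by
    refine tsum_le_of_le_rpow_neg_shift (by linarith) hm' (by positivity)
      (fun k => by positivity) fun k => ?_
    refine (pow_le_pow_left₀ (norm_nonneg _) (hu (k + m)) 2).trans_eq ?_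
    have hy : (0 : ℝ) ≤ m + 1 + k := by positivity
    have e : decayWeight s (k + m) 0 = ((m : ℝ) + 1 + k) ^ (-s) := by
      unfold decayWeight
      push_cast
      rw [sub_zero, abs_of_nonneg (by positivity)]
      congr 1; ring
    rw [e, mul_pow, ← Real.rpow_natCast (((m : ℝ) + 1 + k) ^ (-s)), ← Real.rpow_mul hy]
    congr 2; push_cast; ring
  refine abs_le_of_sq_le_sq' ?_ (by positivity) |>.2
  have hsq : ((n : ℝ) ^ (-(s - 1 / 2))) ^ 2 = (n : ℝ) ^ (-(2 * s - 1)) := by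
    rw [← Real.rpow_natCast, ← Real.rpow_mul hn'.le]
    congr 1; push_cast; ring
  have hmono : (m : ℝ) ^ (-(2 * s - 1)) ≤ (n : ℝ) ^ (-(2 * s - 1)) :=
    Real.rpow_le_rpow_of_nonpos hn' hnm' (by linarith)
  calc _ ≤ B * ∑' k, ‖inner 𝕜 (ψ (k + m)) u‖ ^ 2 := h.norm_sub_partialFrameOp_sq_le hS m u
    _ ≤ B * (b ^ 2 * ((n : ℝ) ^ (-(2 * s - 1)) / (2 * s - 1))) := by
      refine mul_le_mul_of_nonneg_left (htail.trans ?_) hB.le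
      gcongr
    _ = _ := by rw [mul_pow, mul_pow, Real.sq_sqrt (by positivity), hsq]; ring

end FiniteSection

end CasazzaChristensen

open CasazzaChristensen in
theorem theorem3p1 {𝕜 : Type*} [RCLike 𝕜] {H : Type*} [NormedAddCommGroup H]
    [InnerProductSpace 𝕜 H] [CompleteSpace H]
    (ψ : ℕ → H) (A B s c₀ c₁ : ℝ) (f : H)
    (hframe : IsFrame 𝕜 ψ A B)
    (hs : 1 < s)
    (hloc : IsSelfLocalized 𝕜 ψ c₀ s)
    (hf : HasCoeffDecay 𝕜 ψ f c₁ s) :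
    ∃ S : H ≃L[𝕜] H, IsFrameOperator 𝕜 ψ (S : H →L[𝕜] H) ∧
      ∃ C : ℝ, 0 < C ∧
        ∀ n : ℕ, 1 ≤ n → ∀ J : Finset (Fin n), IsGramCore 𝕜 ψ n J →
          ∀ m : ℕ, sampleSize A c₀ s (gramMinEigenvalue 𝕜 ψ n J) n ≤ (m : ℝ) →
            ∃ V : headSpan 𝕜 ψ n ≃L[𝕜] headSpan 𝕜 ψ n,
              (V : headSpan 𝕜 ψ n →L[𝕜] headSpan 𝕜 ψ n) = compressedOp 𝕜 ψ n m ∧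
              ‖S.symm f - (V.symm (headProj 𝕜 ψ n f) : H)‖ ≤ C * (n : ℝ) ^ (-(s - 1 / 2)) := by
  obtain ⟨S, hS⟩ := hframe.exists_frameOperator_equiv
  refine ⟨S, hS, ?_⟩
  have hA := hframe.1
  have hB := hframe.2.1
  have hl : (S.symm : H →L[𝕜] H) * (S : H →L[𝕜] H) = 1 := by ext x; simp
  have hr : (S : H →L[𝕜] H) * (S.symm : H →L[𝕜] H) = 1 := by ext x; simp
  have hR := hframe.norm_one_sub_frameOperator_lt_one hS
  have hfdec : DecaysAt 𝕜 ψ s 0 c₁ f := fun j => by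
    have := hf.2 j
    unfold decayWeight
    rwa [Nat.cast_zero, sub_zero, abs_of_nonneg j.cast_nonneg, add_comm]
  obtain ⟨b₁, hb₁⟩ := hfdec.inverse_frameOperator hs hloc hS hR hl hr
  -- The second inversion gives decay for k = S⁻¹g, so that g = Sk can be approximated from H_n by
  -- S_n k.
  obtain ⟨b₂, hb₂⟩ := hb₁.inverse_frameOperator hs hloc hS hR hl hr
  set g := S.symm f with hg
  set k := S.symm g with hk
  set D := Real.sqrt (B / (2 * s - 1)) with hD
  have hb₁0 : 0 ≤ b₁ := hb₁.nonneg
  have hb₂0 : 0 ≤ b₂ := hb₂.nonneg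
  refine ⟨D * b₂ + 2 / A * (D * b₁ + B * (D * b₂)) + 1, by positivity, ?_⟩
  intro n hn J hJ m hm
  have hlam : 0 ≤ gramMinEigenvalue 𝕜 ψ n J := by
    -- Empty J means H_n = {0}: the infimum over the empty type is 0, and division by 0 makes the
    -- bracket in `sampleSize` vanish.
    rcases J.eq_empty_or_nonempty with rfl | hne
    · simp [gramMinEigenvalue]
    · exact (hJ.gramMinEigenvalue_pos hne).le
  have hnm : n ≤ m := by
    exact_mod_cast (natCast_le_sampleSize hA.le (by linarith) hlam).trans hm
  have hlow : ∀ v : headSpan 𝕜 ψ n, A / 2 * ‖v‖ ≤ ‖compressedOp 𝕜 ψ n m v‖ := fun v =>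
    norm_le_norm_compressedOp v (hframe.half_lower_bound_on_headSpan hloc hs hn hJ hm v.2)
  obtain ⟨V, hV⟩ := exists_compressedOp_equiv hA hlow
  refine ⟨V, hV, ?_⟩
  set N := (n : ℝ) ^ (-(s - 1 / 2)) with hN
  have hN0 : 0 ≤ N := by positivity
  have e1 : ‖f - partialFrameOp 𝕜 ψ m g‖ ≤ D * b₁ * N := by
    have := hframe.norm_sub_partialFrameOp_le hs hS hb₁ hn hnm
    rwa [show (S : H →L[𝕜] H) ((S.symm : H →L[𝕜] H) f) = f from S.apply_symm_apply f] at this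
  have e2 : ‖g - partialFrameOp 𝕜 ψ n k‖ ≤ D * b₂ * N := by
    have := hframe.norm_sub_partialFrameOp_le hs hS hb₂ hn le_rfl
    rwa [show (S : H →L[𝕜] H) ((S.symm : H →L[𝕜] H) ((S.symm : H →L[𝕜] H) f)) = g from
      S.apply_symm_apply _] at this
  set u : headSpan 𝕜 ψ n := ⟨partialFrameOp 𝕜 ψ n k, partialFrameOp_mem_headSpan n k⟩ with hu
  set y := V.symm (headProj 𝕜 ψ n f) with hy
  -- Since V y = P_n f, the residual splits into the truncation error of f = Sg and the image under
  -- S_m of the error of u as an approximation to g.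
  have hVy : compressedOp 𝕜 ψ n m (y - u) =
      headProj 𝕜 ψ n ((f - partialFrameOp 𝕜 ψ m g) + partialFrameOp 𝕜 ψ m (g - u)) := by
    have h1 : compressedOp 𝕜 ψ n m y = headProj 𝕜 ψ n f := by
      rw [← hV]; exact V.apply_symm_apply _
    rw [map_sub, h1, compressedOp_apply, ← map_sub, map_sub (partialFrameOp 𝕜 ψ m)]
    congr 1
    abel
  have e3 : A / 2 * ‖y - u‖ ≤ D * b₁ * N + B * (D * b₂ * N) := by
    refine (hlow _).trans ?_
    rw [hVy]
    refine (norm_headProj_le _ _).trans ((norm_add_le _ _).trans (add_le_add e1 ?_))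
    exact (hframe.norm_partialFrameOp_le m _).trans (mul_le_mul_of_nonneg_left e2 hB.le)
  have e4 : ‖y - u‖ ≤ 2 / A * (D * b₁ * N + B * (D * b₂ * N)) := by
    have := mul_le_mul_of_nonneg_left e3 (show 0 ≤ 2 / A by positivity)
    calc ‖y - u‖ = 2 / A * (A / 2 * ‖y - u‖) := by field_simp
      _ ≤ _ := this
  have e5 : g - (y : H) = (g - (u : H)) - ((y - u : headSpan 𝕜 ψ n) : H) := by
    push_cast; abel
  calc ‖g - (y : H)‖ ≤ ‖g - (u : H)‖ + ‖y - u‖ := by rw [e5]; exact norm_sub_le _ _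
    _ ≤ D * b₂ * N + 2 / A * (D * b₁ * N + B * (D * b₂ * N)) := add_le_add e2 e4
    _ ≤ _ := by linarith
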